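/- Let $k\ge 1$. For $p\in\{2,\infty\}$ let $(H^p)^{m\times n}$ be the space of $m\times n$ matrices with entries in $L^p(\mathbb T)$ whose Fourier coefficients of negative index vanish; its elements are identified with the corresponding analytic functions on the unit disk, so that $F(0)$ and $F'(0)$ make sense. Let $(H^\infty_1)^{k\times k}=\{F\in (H^\infty)^{k\times k}: F'(0)=0\}$. A function $J\in (H^\infty)^{\ell\times k}$ is called co-inner if $J(z)J(z)^*=I_\ell$ for almost every $z\in\mathbb T$. Let $\overline{\mathbb G}(\ell'\times\ell)$ be the set of pairs $(\alpha,\beta)$ of complex $\ell'\times\ell$ matrices with $\alpha\alpha^*+\beta\beta^*=I_{\ell'}$, and for such a pair let $$H^2_{\alpha,\beta}=\{F\in (H^2)^{k\times \ell}: \text{for some } U\in\mathbb C^{k\times\ell'},\ F(0)=U\alpha \text{ and } F'(0)=U\beta\}.$$ **Theorem.** Let $\mathcal M$ be a nonzero closed linear subspace of $(H^2)^{k\times k}$ such that $F h\in\mathcal M$ for all $F\in (H^\infty_1)^{k\times k}$ and all $h\in\mathcal M$. Then there are integers $\ell,\ell'$ with $1\le \ell\le k$ and $\ell\le\ell'\le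 2\ell$, a co-inner function $J\in (H^\infty)^{\ell\times k}$ and a pair $(\alpha,\beta)\in\overline{\mathbb G}(\ell'\times\ell)$ such that $$\mathcal M = H^2_{\alpha,\beta}\cdot J=\{F J: F\in H^2_{\alpha,\beta}\}.$$ -/

import Mathlib

open MeasureTheory
open scoped ENNReal Matrix

noncomputable section

namespace ConstrainedHardy

/-- The unit circle, parametrised by the angle `θ` (modulo `2π`) of the point `z = exp (iθ)`.
Here `fourier n θ = exp (inθ) = z ^ n`, and the measure used throughout is
normalised arc length `|dz| / 2π`, i.e. `AddCircle.haarAddCircle`. -/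
abbrev UCircle : Type := AddCircle (2 * Real.pi)

instance factTwoPiPos : Fact (0 < 2 * Real.pi) := ⟨Real.two_pi_pos⟩

/-- The scalar space `L^p` of the circle. -/
abbrev LCirc (p : ℝ≥0∞) : Type := Lp ℂ p (AddCircle.haarAddCircle (T := 2 * Real.pi))

/-- `k × l` matrices with entries in `L^p`. The topology is the entrywise one; for `p = 2` this
is the topology of the Hilbert space norm `‖F‖² = ∫ trace (F* F) |dz| / 2π`. -/
abbrev MatL (p : ℝ≥0∞) (k l : ℕ) : Type := Matrix (Fin k) (Fin l) (LCirc p)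

/-- The power series `∑_{n ≥ 0} f̂(n) z ^ n`: for an analytic `f`, this is the holomorphic function
on the unit disk with boundary function `f`. -/
def diskExt (f : UCircle → ℂ) (z : ℂ) : ℂ := ∑' n : ℕ, fourierCoeff f (n : ℤ) * z ^ n

theorem fourierCoeff_bdd (f : UCircle → ℂ) (n : ℤ) :
    ‖fourierCoeff f n‖ ≤ ∫ t, ‖f t‖ ∂(AddCircle.haarAddCircle (T := 2 * Real.pi)) := by
  unfold fourierCoeff
  refine (norm_integral_le_integral_norm _).trans (le_of_eq ?_)
  congr 1; ext t
  rw [norm_smul, fourier_apply, Circle.norm_coe, one_mul]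

/-- The value of `diskExt f` at `0` is the zeroth Fourier coefficient. -/
theorem diskExt_zero (f : UCircle → ℂ) : diskExt f 0 = fourierCoeff f 0 := by
  unfold diskExt
  rw [tsum_eq_single 0]
  · simp
  · intro n hn; simp [hn]

/-- The derivative of `diskExt f` at `0` is the first Fourier coefficient. -/
theorem deriv_diskExt_zero (f : UCircle → ℂ) : deriv (diskExt f) 0 = fourierCoeff f 1 := by
  set C := ∫ t, ‖f t‖ ∂(AddCircle.haarAddCircle (T := 2 * Real.pi))
  have h : HasFPowerSeriesOnBall (diskExt f)
      (FormalMultilinearSeries.ofScalars ℂ (fun n : ℕ => fourierCoeff f (n : ℤ))) 0 1 := by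
    refine ⟨?_, by simp, ?_⟩
    · refine FormalMultilinearSeries.le_radius_of_bound _ (r := 1) C ?_
      intro n
      simpa using fourierCoeff_bdd f n
    · intro y hy
      have hy' : ‖y‖ < 1 := by
        simpa [Metric.mem_eball, edist_zero_right, ← ofReal_norm, ENNReal.ofReal_lt_one] using hy
      have : Summable fun n : ℕ => fourierCoeff f (n : ℤ) * y ^ n := by
        refine Summable.of_norm_bounded (g := fun n => C * ‖y‖ ^ n) ((summable_geometric_of_lt_one (norm_nonneg _) hy').mul_left C) ?_
        intro n
        rw [norm_mul, norm_pow]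
        exact mul_le_mul_of_nonneg_right (fourierCoeff_bdd f n) (by positivity)
      simpa [diskExt, mul_comm] using this.hasSum
  simpa using h.hasFPowerSeriesAt.deriv

/-- A matrix function on the circle is analytic if no entry has a nonzero Fourier coefficient of
negative index. -/
def IsAnalytic {p : ℝ≥0∞} {k l : ℕ} (F : MatL p k l) : Prop :=
  ∀ i j, ∀ n : ℤ, n < 0 → fourierCoeff (F i j) n = 0

/-- The Hardy space `(H^p)^{k × l}` (used for `p = 2` and `p = ∞`). -/
def Hardy (p : ℝ≥0∞) (k l : ℕ) : Set (MatL p k l) := {F | IsAnalytic F}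

/-- The value `F(0)` at the centre of the disk. -/
def valueZero {p : ℝ≥0∞} {k l : ℕ} (F : MatL p k l) : Matrix (Fin k) (Fin l) ℂ :=
  Matrix.of fun i j => diskExt (F i j) 0

/-- The derivative `F'(0)` at the centre of the disk. -/
def derivZero {p : ℝ≥0∞} {k l : ℕ} (F : MatL p k l) : Matrix (Fin k) (Fin l) ℂ :=
  Matrix.of fun i j => deriv (diskExt (F i j)) 0

/-- The constrained algebra `(H^∞_1)^{k × k}` of all `F` in `(H^∞)^{k × k}` with `F'(0) = 0`. -/
def HardyInftyOne (k : ℕ) : Set (MatL ∞ k k) := {F | F ∈ Hardy ∞ k k ∧ derivZero F = 0}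

/-- The pointwise matrix product `F · h` of `F` in `(L^∞)^{k × m}` and `h` in `(L^2)^{m × l}`. -/
def mulLeft {k m l : ℕ} (F : MatL ∞ k m) (h : MatL 2 m l) : MatL 2 k l :=
  Matrix.of fun i j => ∑ s, (F i s • h s j : LCirc 2)

/-- The pointwise matrix product `h · J` of `h` in `(L^2)^{k × m}` and `J` in `(L^∞)^{m × l}`.
The entries are scalar functions, so each product of entries may be written in either order. -/
def mulRight {k m l : ℕ} (h : MatL 2 k m) (J : MatL ∞ m l) : MatL 2 k l :=
  Matrix.of fun i j => ∑ s, (J s j • h i s : LCirc 2)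

/-- The value of (a representative of) `F` at a point of the circle. -/
def pointValue {p : ℝ≥0∞} {k l : ℕ} (F : MatL p k l) (θ : UCircle) : Matrix (Fin k) (Fin l) ℂ :=
  Matrix.of fun i j => F i j θ

/-- `J` is co-inner: it lies in `(H^∞)^{l × k}` and `J(z) J(z)* = I_l` for almost all `z` on the
circle. -/
def IsCoInner {l k : ℕ} (J : MatL ∞ l k) : Prop :=
  J ∈ Hardy ∞ l k ∧
    ∀ᵐ θ ∂(AddCircle.haarAddCircle (T := 2 * Real.pi)), pointValue J θ * (pointValue J θ)ᴴ = 1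

/-- The set of pairs `(α, β)` of `l' × l` matrices with `α α* + β β* = I_{l'}`. -/
def GBar (l' l : ℕ) : Set (Matrix (Fin l') (Fin l) ℂ × Matrix (Fin l') (Fin l) ℂ) :=
  {ab | ab.1 * ab.1ᴴ + ab.2 * ab.2ᴴ = 1}

/-- The space `H^2_{α,β}` of all `F` in `(H^2)^{k × l}` for which there is a `k × l'` matrix `U`
with `F(0) = U α` and `F'(0) = U β`. -/
def HardyAB (k : ℕ) {l' l : ℕ} (α β : Matrix (Fin l') (Fin l) ℂ) : Set (MatL 2 k l) :=
  {F | F ∈ Hardy 2 k l ∧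
    ∃ U : Matrix (Fin k) (Fin l') ℂ, valueZero F = U * α ∧ derivZero F = U * β}

end ConstrainedHardy

end

noncomputable section

namespace ConstrainedHardy

open Filter Topology

local notation "μc" => AddCircle.haarAddCircle (T := 2 * Real.pi)

/-- The pairing of an integrable function on the circle with continuous functions. -/
def integralPairing (f : UCircle → ℂ) (hf : Integrable f μc) : C(UCircle, ℂ) →L[ℂ] ℂ :=
  LinearMap.mkContinuous
    { toFun := fun g => ∫ t, g t * f t ∂μc
      map_add' := fun g h => by
        have hg : ∀ g : C(UCircle, ℂ), Integrable (fun t => g t * f t) μc := fun g =>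
          hf.bdd_mul (c := ‖g‖) g.continuous.aestronglyMeasurable (ae_of_all _ g.norm_coe_le_norm)
        simp only [ContinuousMap.add_apply, add_mul]
        exact integral_add (hg g) (hg h)
      map_smul' := fun c g => by
        simp only [ContinuousMap.smul_apply, smul_eq_mul, mul_assoc, RingHom.id_apply]
        exact integral_const_mul _ _ }
    (∫ t, ‖f t‖ ∂μc) (fun g => by
      refine (norm_integral_le_of_norm_le (hf.norm.const_mul ‖g‖) (ae_of_all _ fun t => ?_)).trans
        (le_of_eq ?_)
      · rw [norm_mul]
        exact mul_le_mul_of_nonneg_right (g.norm_coe_le_norm t) (norm_nonneg _)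
      · rw [integral_const_mul, mul_comm])

theorem integralPairing_apply (f : UCircle → ℂ) (hf : Integrable f μc) (g : C(UCircle, ℂ)) :
    integralPairing f hf g = ∫ t, g t * f t ∂μc := rfl

/-- An integrable function on the circle all of whose Fourier coefficients vanish is zero. -/
theorem ae_eq_zero_of_fourierCoeff_eq_zero {f : UCircle → ℂ} (hf : Integrable f μc)
    (h : ∀ n : ℤ, fourierCoeff f n = 0) : f =ᵐ[μc] 0 := by
  have hzero : ∀ g : C(UCircle, ℂ), ∫ t, g t * f t ∂μc = 0 := by
    have hle : (Submodule.span ℂ (Set.range (@fourier (2 * Real.pi)))).topologicalClosure ≤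
        LinearMap.ker (integralPairing f hf).toLinearMap := by
      refine Submodule.topologicalClosure_minimal _ (Submodule.span_le.2 ?_)
        (integralPairing f hf).isClosed_ker
      rintro _ ⟨n, rfl⟩
      have := h (-n)
      simpa [fourierCoeff, integralPairing_apply] using this
    intro g
    have hg : g ∈ (Submodule.span ℂ (Set.range (@fourier (2 * Real.pi)))).topologicalClosure := by
      rw [span_fourier_closure_eq_top]; trivial
    exact hle hg
  refine ae_eq_zero_of_forall_setIntegral_isClosed_eq_zero hf fun s hs => ?_
  have hlim : Tendsto (fun n => ∫ t, ((hs.apprSeq n t : ℝ) : ℂ) * f t ∂μc) atTop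
      (𝓝 (∫ t, s.indicator f t ∂μc)) := by
    refine tendsto_integral_of_dominated_convergence (fun t => ‖f t‖) ?_ hf.norm ?_ ?_
    · intro n
      refine AEStronglyMeasurable.mul ?_ hf.aestronglyMeasurable
      refine Continuous.aestronglyMeasurable ?_
      exact Complex.continuous_ofReal.comp (NNReal.continuous_coe.comp (hs.apprSeq n).continuous)
    · intro n
      refine ae_of_all _ fun t => ?_
      rw [norm_mul, Complex.norm_real, Real.norm_of_nonneg (NNReal.coe_nonneg _)]
      exact mul_le_of_le_one_left (norm_nonneg _)
        (by exact_mod_cast HasOuterApproxClosed.apprSeq_apply_le_one hs n t)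
    · refine ae_of_all _ fun t => ?_
      have h1 := tendsto_pi_nhds.1 (HasOuterApproxClosed.tendsto_apprSeq hs) t
      have h2 : Tendsto (fun n => ((hs.apprSeq n t : ℝ) : ℂ)) atTop
          (𝓝 (((s.indicator (fun _ => (1 : NNReal)) t : NNReal) : ℝ) : ℂ)) :=
        (Complex.continuous_ofReal.tendsto _).comp ((NNReal.continuous_coe.tendsto _).comp h1)
      have h3 := h2.mul_const (f t)
      convert h3 using 2
      by_cases ht : t ∈ s <;> simp [ht]
  rw [integral_indicator hs.measurableSet] at hlim
  refine tendsto_nhds_unique hlim ?_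
  have : (fun n => ∫ t, ((hs.apprSeq n t : ℝ) : ℂ) * f t ∂μc) = fun _ => 0 := by
    funext n
    exact hzero ⟨fun t => ((hs.apprSeq n t : ℝ) : ℂ),
      Complex.continuous_ofReal.comp (NNReal.continuous_coe.comp (hs.apprSeq n).continuous)⟩
  rw [this]
  exact tendsto_const_nhds

theorem fourierCoeff_const (c : ℂ) (n : ℤ) (hn : n ≠ 0) :
    fourierCoeff (fun _ : UCircle => c) n = 0 := by
  have h := fourierCoeff_fourier (T := 2 * Real.pi) 0
  have h2 : fourierCoeff (c • fun x : UCircle => fourier 0 x) n = 0 := by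
    rw [fourierCoeff.const_smul, h]
    simp [hn]
  convert h2 using 2
  funext x; simp

theorem fourierCoeff_const_zero (c : ℂ) : fourierCoeff (fun _ : UCircle => c) 0 = c := by
  simp [fourierCoeff]

/-- An integrable function on the circle whose Fourier coefficients of nonzero index vanish is
constant. -/
theorem ae_eq_const_of_fourierCoeff_eq_zero {f : UCircle → ℂ} (hf : Integrable f μc)
    (h : ∀ n : ℤ, n ≠ 0 → fourierCoeff f n = 0) : ∀ᵐ t ∂μc, f t = fourierCoeff f 0 := by
  have hc : Integrable (fun _ : UCircle => -fourierCoeff f 0) μc := integrable_const _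
  have := ae_eq_zero_of_fourierCoeff_eq_zero (hf.add hc) (fun n => by
    rw [fourierCoeff.add hf hc, Pi.add_apply]
    rcases eq_or_ne n 0 with rfl | hn
    · rw [fourierCoeff_const_zero, add_neg_cancel]
    · rw [h n hn, fourierCoeff_const _ _ hn, add_zero])
  filter_upwards [this] with t ht
  simpa [add_neg_eq_zero] using ht

/-- Multiplication by a bounded function on `L²`. -/
def mulL (a : LCirc ∞) : LCirc 2 →L[ℂ] LCirc 2 :=
  LinearMap.mkContinuous
    { toFun := fun f => (a • f : LCirc 2)
      map_add' := fun f g => Lp.add_smul a f g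
      map_smul' := fun c f => (Lp.smul_comm c a f).symm }
    ‖a‖ (fun f => Lp.norm_smul_le a f)

theorem coeFn_mulL (a : LCirc ∞) (f : LCirc 2) : mulL a f =ᵐ[μc] fun t => a t * f t :=
  Lp.coeFn_lpSMul a f

theorem coeFn_mulL_fourierLp (n : ℤ) (f : LCirc 2) :
    mulL (fourierLp ∞ n) f =ᵐ[μc] fun t => fourier n t * f t := by
  filter_upwards [coeFn_mulL (fourierLp ∞ n) f, coeFn_fourierLp (T := 2 * Real.pi) ∞ n]
    with t h1 h2
  rw [h1, h2]

theorem mulL_comm (a b : LCirc ∞) (f : LCirc 2) : mulL a (mulL b f) = mulL b (mulL a f) := by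
  apply Lp.ext
  filter_upwards [coeFn_mulL a (mulL b f), coeFn_mulL b f, coeFn_mulL b (mulL a f),
    coeFn_mulL a f] with t h1 h2 h3 h4
  rw [h1, h2, h3, h4]; ring

theorem mulL_fourierLp_fourierLp (m n : ℤ) (f : LCirc 2) :
    mulL (fourierLp ∞ m) (mulL (fourierLp ∞ n) f) = mulL (fourierLp ∞ (m + n)) f := by
  apply Lp.ext
  filter_upwards [coeFn_mulL_fourierLp m (mulL (fourierLp ∞ n) f), coeFn_mulL_fourierLp n f,
    coeFn_mulL_fourierLp (m + n) f] with t h1 h2 h3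
  rw [h1, h2, h3, fourier_add]; ring

theorem mulL_fourierLp_zero (f : LCirc 2) : mulL (fourierLp ∞ 0) f = f := by
  apply Lp.ext
  filter_upwards [coeFn_mulL_fourierLp 0 f] with t h1
  rw [h1, fourier_zero, one_mul]

theorem norm_mulL_fourierLp (n : ℤ) (f : LCirc 2) : ‖mulL (fourierLp ∞ n) f‖ = ‖f‖ := by
  rw [Lp.norm_def, Lp.norm_def]
  congr 1
  apply eLpNorm_congr_norm_ae
  filter_upwards [coeFn_mulL_fourierLp n f] with t h1
  rw [h1, norm_mul, fourier_apply, Circle.norm_coe, one_mul]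

/-- Multiplication by `z ^ n` as a unitary operator on `L²` of the circle. -/
def zmul (n : ℤ) : LCirc 2 ≃ₗᵢ[ℂ] LCirc 2 where
  toFun := mulL (fourierLp ∞ n)
  invFun := mulL (fourierLp ∞ (-n))
  map_add' := map_add _
  map_smul' := map_smul _
  left_inv f := by rw [mulL_fourierLp_fourierLp, neg_add_cancel, mulL_fourierLp_zero]
  right_inv f := by rw [mulL_fourierLp_fourierLp, add_neg_cancel, mulL_fourierLp_zero]
  norm_map' := norm_mulL_fourierLp n

theorem zmul_apply (n : ℤ) (f : LCirc 2) : zmul n f = mulL (fourierLp ∞ n) f := rfl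

theorem coeFn_zmul (n : ℤ) (f : LCirc 2) : zmul n f =ᵐ[μc] fun t => fourier n t * f t :=
  coeFn_mulL_fourierLp n f

theorem zmul_zmul (m n : ℤ) (f : LCirc 2) : zmul m (zmul n f) = zmul (m + n) f :=
  mulL_fourierLp_fourierLp m n f

theorem zmul_zero (f : LCirc 2) : zmul 0 f = f := mulL_fourierLp_zero f

theorem fourierCoeff_zmul (n m : ℤ) (f : LCirc 2) :
    fourierCoeff (zmul n f) m = fourierCoeff f (m - n) := by
  unfold fourierCoeff
  apply integral_congr_ae
  filter_upwards [coeFn_zmul n f] with t ht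
  rw [ht, smul_eq_mul, smul_eq_mul, ← mul_assoc, ← fourier_add]
  congr 3; ring

/-- The `n`-th Fourier coefficient as a continuous functional on `L²`. -/
def coeff (n : ℤ) : LCirc 2 →L[ℂ] ℂ := innerSL ℂ (fourierLp 2 n)

theorem coeff_apply (n : ℤ) (f : LCirc 2) : coeff n f = fourierCoeff f n := by
  rw [← fourierBasis_repr, HilbertBasis.repr_apply_apply, coe_fourierBasis]
  rfl

theorem coeff_zmul (n m : ℤ) (f : LCirc 2) : coeff m (zmul n f) = coeff (m - n) f := by
  rw [coeff_apply, coeff_apply, fourierCoeff_zmul]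

theorem coeff_fourierLp (n m : ℤ) : coeff n (fourierLp 2 m) = if n = m then 1 else 0 :=
  orthonormal_iff_ite.1 orthonormal_fourier n m

theorem eq_zero_of_coeff_eq_zero {f : LCirc 2} (h : ∀ n, coeff n f = 0) : f = 0 := by
  refine (fourierBasis (T := 2 * Real.pi)).repr.injective ?_
  ext n
  rw [fourierBasis_repr, ← coeff_apply, h n, map_zero]; rfl

theorem hasSum_coeff_smul (f : LCirc 2) : HasSum (fun n => coeff n f • fourierLp 2 n) f := by
  simpa only [coeff_apply] using hasSum_fourier_series_L2 f

/-- Row vectors with entries in `L²` of the circle, as a Hilbert space. -/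
abbrev Row (k : ℕ) : Type := PiLp 2 (fun _ : Fin k => LCirc 2)

/-- Multiplication of row vectors by `z ^ n`. -/
def shift {k : ℕ} (n : ℤ) : Row k ≃ₗᵢ[ℂ] Row k :=
  LinearIsometryEquiv.piLpCongrRight 2 (fun _ => zmul n)

theorem shift_apply {k : ℕ} (n : ℤ) (f : Row k) (j : Fin k) : shift n f j = zmul n (f j) := rfl

theorem shift_shift {k : ℕ} (m n : ℤ) (f : Row k) : shift m (shift n f) = shift (m + n) f := by
  ext1 j; simp only [shift_apply, zmul_zmul]

theorem shift_zero {k : ℕ} (f : Row k) : shift 0 f = f := by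
  ext1 j; simp only [shift_apply, zmul_zero]

theorem shift_neg_shift {k : ℕ} (n : ℤ) (f : Row k) : shift (-n) (shift n f) = f := by
  rw [shift_shift, neg_add_cancel, shift_zero]

theorem shift_shift_neg {k : ℕ} (n : ℤ) (f : Row k) : shift n (shift (-n) f) = f := by
  rw [shift_shift, add_neg_cancel, shift_zero]

theorem inner_shift_left {k : ℕ} (n : ℤ) (f g : Row k) :
    inner ℂ (shift n f) g = inner ℂ f (shift (-n) g) := by
  rw [← (shift n).inner_map_map f, shift_shift_neg]

/-- The `n`-th Fourier coefficient of the `j`-th entry. -/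
def rowCoeff {k : ℕ} (j : Fin k) (n : ℤ) : Row k →L[ℂ] ℂ := coeff n ∘L PiLp.proj 2 _ j

theorem rowCoeff_apply {k : ℕ} (j : Fin k) (n : ℤ) (f : Row k) :
    rowCoeff j n f = coeff n (f j) := rfl

theorem rowCoeff_shift {k : ℕ} (j : Fin k) (n m : ℤ) (f : Row k) :
    rowCoeff j m (shift n f) = rowCoeff j (m - n) f := coeff_zmul n m (f j)

theorem eq_zero_of_rowCoeff_eq_zero {k : ℕ} {f : Row k} (h : ∀ j n, rowCoeff j n f = 0) :
    f = 0 := by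
  ext1 j; exact eq_zero_of_coeff_eq_zero (h j)

/-- The row vectors with entries in the Hardy space `H²`. -/
def hardyRow (k : ℕ) : Submodule ℂ (Row k) :=
  ⨅ (j : Fin k) (n : {n : ℤ // n < 0}), LinearMap.ker (rowCoeff j n.1).toLinearMap

theorem mem_hardyRow {k : ℕ} {f : Row k} :
    f ∈ hardyRow k ↔ ∀ j, ∀ n : ℤ, n < 0 → rowCoeff j n f = 0 := by
  simp [hardyRow, Submodule.mem_iInf]

theorem isClosed_hardyRow (k : ℕ) : IsClosed (hardyRow k : Set (Row k)) := by
  simp only [hardyRow, Submodule.coe_iInf]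
  exact isClosed_iInter fun j => isClosed_iInter fun n => (rowCoeff j n.1).isClosed_ker

theorem shift_mem_hardyRow {k : ℕ} {n : ℤ} (hn : 0 ≤ n) {f : Row k} (hf : f ∈ hardyRow k) :
    shift n f ∈ hardyRow k := by
  rw [mem_hardyRow] at hf ⊢
  intro j m hm
  rw [rowCoeff_shift]
  exact hf j _ (by omega)

/-- The row vector with entries `z ^ n` at `j` and zero elsewhere. -/
def monoRow {k : ℕ} (j : Fin k) (n : ℤ) : Row k := PiLp.single 2 j (fourierLp 2 n)

theorem monoRow_mem_hardyRow {k : ℕ} (j : Fin k) {n : ℤ} (hn : 0 ≤ n) :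
    monoRow j n ∈ hardyRow k := by
  rw [mem_hardyRow]
  intro i m hm
  rw [rowCoeff_apply, monoRow]
  rcases eq_or_ne i j with rfl | hij
  · simp only [PiLp.single_apply, if_true]
    rw [coeff_fourierLp, if_neg (by omega)]
  · simp [hij]

theorem hardyRow_le_of_monoRow_mem {k : ℕ} {P : Submodule ℂ (Row k)} (hP : IsClosed (P : Set (Row k)))
    (h : ∀ (j : Fin k) (n : ℕ), monoRow j n ∈ P) : hardyRow k ≤ P := by
  intro f hf
  rw [mem_hardyRow] at hf
  have hsum : f = ∑ j, (PiLp.single 2 j (f j) : Row k) := by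
    ext1 i
    simp [Finset.sum_apply]
  rw [hsum]
  refine P.sum_mem fun j _ => ?_
  let e : LCirc 2 →L[ℂ] Row k :=
    (PiLp.continuousLinearEquiv 2 ℂ (fun _ : Fin k => LCirc 2)).symm.toContinuousLinearMap ∘L
      ContinuousLinearMap.single ℂ (fun _ : Fin k => LCirc 2) j
  refine hP.mem_of_tendsto ((hasSum_coeff_smul (f j)).mapL e) (Eventually.of_forall fun s => ?_)
  refine P.sum_mem fun n _ => ?_
  rw [map_smul]
  rcases lt_or_ge n 0 with hn | hn
  · have : coeff n (f j) = 0 := hf j n hn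
    rw [this, zero_smul]
    exact P.zero_mem
  · lift n to ℕ using hn
    exact P.smul_mem _ (h j n)

/-- The product of row vectors in `L²` with a bounded matrix function. -/
def rowMul {l k : ℕ} (J : MatL ∞ l k) : Row l →L[ℂ] Row k :=
  (PiLp.continuousLinearEquiv 2 ℂ (fun _ : Fin k => LCirc 2)).symm.toContinuousLinearMap ∘L
    ContinuousLinearMap.pi fun j => ∑ s, mulL (J s j) ∘L PiLp.proj 2 _ s

theorem rowMul_apply {l k : ℕ} (J : MatL ∞ l k) (f : Row l) (j : Fin k) :
    rowMul J f j = ∑ s, mulL (J s j) (f s) := by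
  simp [rowMul]

theorem rowMul_shift {l k : ℕ} (J : MatL ∞ l k) (n : ℤ) (f : Row l) :
    rowMul J (shift n f) = shift n (rowMul J f) := by
  ext1 j
  simp only [rowMul_apply, shift_apply, map_sum, zmul_apply]
  exact Finset.sum_congr rfl fun s _ => mulL_comm _ _ _

theorem coeFn_rowMul {l k : ℕ} (J : MatL ∞ l k) (f : Row l) :
    ∀ᵐ t ∂μc, (fun j => rowMul J f j t) = (fun s => f s t) ᵥ* pointValue J t := by
  have h1 : ∀ᵐ t ∂μc, ∀ s j, mulL (J s j) (f s) t = J s j t * f s t :=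
    ae_all_iff.2 fun s => ae_all_iff.2 fun j => coeFn_mulL (J s j) (f s)
  have h2 : ∀ᵐ t ∂μc, ∀ j, rowMul J f j t = ∑ s, mulL (J s j) (f s) t :=
    ae_all_iff.2 fun j => by
      rw [rowMul_apply]
      exact Lp.coeFn_fun_finsetSum _ _
  filter_upwards [h1, h2] with t h1 h2
  funext j
  simp only [h2, h1, Matrix.vecMul, dotProduct, pointValue, Matrix.of_apply, mul_comm]

theorem integrable_rowInner {k : ℕ} (f g : Row k) :
    Integrable (fun t => ∑ j, g j t * star (f j t)) μc :=
  integrable_finsetSum _ fun j _ => L2.integrable_inner (𝕜 := ℂ) (f j) (g j)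

theorem inner_shift_eq_fourierCoeff {k : ℕ} (n : ℤ) (f g : Row k) :
    inner ℂ (shift n f) g = fourierCoeff (fun t => ∑ j, g j t * star (f j t)) n := by
  have h : fourierCoeff (fun t => ∑ j, g j t * star (f j t)) n
      = ∑ j, fourierCoeff (fun t => g j t * star (f j t)) n := by
    have := congrFun (fourierCoeff.sum (T := 2 * Real.pi) Finset.univ
      (fun j t => g j t * star (f j t))
      (fun j _ => L2.integrable_inner (𝕜 := ℂ) (f j) (g j))) n
    simpa [Finset.sum_fn] using this
  rw [h, PiLp.inner_apply]
  refine Finset.sum_congr rfl fun j _ => ?_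
  rw [L2.inner_def, fourierCoeff]
  refine integral_congr_ae ?_
  filter_upwards [coeFn_zmul n (f j)] with t ht
  rw [shift_apply, ht, fourier_neg, RCLike.inner_apply, map_mul, smul_eq_mul]
  simp only [starRingEnd_apply]
  ring

theorem inner_eq_integral {k : ℕ} (f g : Row k) :
    inner ℂ f g = ∫ t, ∑ j, g j t * star (f j t) ∂μc := by
  have := inner_shift_eq_fourierCoeff 0 f g
  rw [shift_zero] at this
  rw [this]
  simp [fourierCoeff]

theorem norm_rowMul {l k : ℕ} {J : MatL ∞ l k}
    (hJ : ∀ᵐ t ∂μc, pointValue J t * (pointValue J t)ᴴ = 1) (f : Row l) :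
    ‖rowMul J f‖ = ‖f‖ := by
  have h : inner ℂ (rowMul J f) (rowMul J f) = inner ℂ f f := by
    rw [inner_eq_integral, inner_eq_integral]
    refine integral_congr_ae ?_
    filter_upwards [hJ, coeFn_rowMul J f] with t h1 h2
    change (fun j => rowMul J f j t) ⬝ᵥ star (fun j => rowMul J f j t)
      = (fun s => f s t) ⬝ᵥ star (fun s => f s t)
    rw [h2, Matrix.star_vecMul, Matrix.dotProduct_mulVec, Matrix.vecMul_vecMul, h1,
      Matrix.vecMul_one]
  rw [inner_self_eq_norm_sq_to_K, inner_self_eq_norm_sq_to_K] at h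
  have h' : ‖rowMul J f‖ ^ 2 = ‖f‖ ^ 2 := by exact_mod_cast h
  exact (sq_eq_sq₀ (norm_nonneg _) (norm_nonneg _)).1 h'

/-- Multiplication by a matrix function with orthonormal rows, as an isometry. -/
def rowMulIsometry {l k : ℕ} (J : MatL ∞ l k)
    (hJ : ∀ᵐ t ∂μc, pointValue J t * (pointValue J t)ᴴ = 1) : Row l →ₗᵢ[ℂ] Row k :=
  ⟨(rowMul J).toLinearMap, norm_rowMul hJ⟩

/-- The preimage of a subspace under multiplication by `z ^ n`. -/
def shiftComap {k : ℕ} (n : ℤ) (Q : Submodule ℂ (Row k)) : Submodule ℂ (Row k) :=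
  Q.comap (shift n).toLinearEquiv.toLinearMap

theorem mem_shiftComap {k : ℕ} {n : ℤ} {Q : Submodule ℂ (Row k)} {f : Row k} :
    f ∈ shiftComap n Q ↔ shift n f ∈ Q := Iff.rfl

theorem isClosed_shiftComap {k : ℕ} (n : ℤ) {Q : Submodule ℂ (Row k)}
    (hQ : IsClosed (Q : Set (Row k))) : IsClosed (shiftComap n Q : Set (Row k)) :=
  hQ.preimage (shift n).continuous

/-- The image of a subspace under multiplication by `z`. -/
def shiftImage {k : ℕ} (P : Submodule ℂ (Row k)) : Submodule ℂ (Row k) := shiftComap (-1) P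

theorem mem_shiftImage {k : ℕ} {P : Submodule ℂ (Row k)} {f : Row k} :
    f ∈ shiftImage P ↔ shift (-1) f ∈ P := Iff.rfl

theorem isClosed_shiftImage {k : ℕ} {P : Submodule ℂ (Row k)} (hP : IsClosed (P : Set (Row k))) :
    IsClosed (shiftImage P : Set (Row k)) :=
  isClosed_shiftComap (-1) hP

/-- The wandering subspace of a subspace which is invariant under multiplication by `z`. -/
def wandering {k : ℕ} (P : Submodule ℂ (Row k)) : Submodule ℂ (Row k) := P ⊓ (shiftImage P)ᗮ

theorem shift_nat_mem {k : ℕ} {P : Submodule ℂ (Row k)} (hinv : ∀ f ∈ P, shift 1 f ∈ P)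
    {f : Row k} (hf : f ∈ P) (n : ℕ) : shift n f ∈ P := by
  induction n with
  | zero => rwa [Nat.cast_zero, shift_zero]
  | succ n ih =>
    have := hinv _ ih
    rwa [shift_shift, add_comm] at this

theorem eq_zero_of_orthogonal_wandering {k : ℕ} {P : Submodule ℂ (Row k)}
    (hP : IsClosed (P : Set (Row k))) (hH : P ≤ hardyRow k) {f : Row k} (hf : f ∈ P)
    (horth : ∀ n : ℕ, ∀ w ∈ wandering P, inner ℂ (shift n w) f = 0)
    (hinv : ∀ f ∈ P, shift 1 f ∈ P) : f = 0 := by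
  have hmem : ∀ n : ℕ, shift (-(n : ℤ)) f ∈ P := by
    intro n
    induction n with
    | zero => simpa [shift_zero] using hf
    | succ n ih =>
      have : CompleteSpace (shiftImage P) := (isClosed_shiftImage hP).completeSpace_coe
      obtain ⟨p, hp, q, hq, hpq⟩ :=
        (shiftImage P).exists_add_mem_mem_orthogonal (shift (-(n : ℤ)) f)
      have hpP : p ∈ P := by
        have := hinv _ (mem_shiftImage.1 hp)
        rwa [shift_shift_neg] at this
      have hqP : q ∈ P := by
        have : q = shift (-(n : ℤ)) f - p := by rw [hpq, add_sub_cancel_left]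
        rw [this]
        exact P.sub_mem ih hpP
      have h1 : inner ℂ q (shift (-(n : ℤ)) f) = 0 := by
        rw [← inner_shift_left]
        exact horth n q ⟨hqP, hq⟩
      rw [hpq, inner_add_right, Submodule.inner_left_of_mem_orthogonal hp hq, zero_add,
        inner_self_eq_zero] at h1
      rw [h1, add_zero] at hpq
      rw [← hpq, mem_shiftImage, shift_shift] at hp
      convert hp using 2
      push_cast
      ring_nf
  refine eq_zero_of_rowCoeff_eq_zero fun j m => ?_
  obtain ⟨n, hn⟩ : ∃ n : ℕ, m - n < 0 := ⟨(m + 1).toNat, by omega⟩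
  have h2 := mem_hardyRow.1 (hH (hmem n)) j (m - n) hn
  rw [rowCoeff_shift] at h2
  convert h2 using 2
  ring_nf

theorem inner_shift_eq_zero_of_mem_wandering {k : ℕ} {P : Submodule ℂ (Row k)}
    (hinv : ∀ f ∈ P, shift 1 f ∈ P) {u v : Row k} (hu : u ∈ P) (hv : v ∈ wandering P) (n : ℕ) :
    inner ℂ (shift ((n : ℤ) + 1) u) v = 0 := by
  refine Submodule.inner_right_of_mem_orthogonal (K := shiftImage P) ?_ hv.2
  rw [mem_shiftImage, shift_shift]
  convert shift_nat_mem hinv hu n using 2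
  ring_nf

/-- Elements of the wandering subspace have pointwise constant inner products. -/
theorem ae_inner_eq_of_mem_wandering {k : ℕ} {P : Submodule ℂ (Row k)}
    (hinv : ∀ f ∈ P, shift 1 f ∈ P) {u v : Row k} (hu : u ∈ wandering P) (hv : v ∈ wandering P) :
    ∀ᵐ t ∂μc, ∑ j, v j t * star (u j t) = inner ℂ u v := by
  have h0 : inner ℂ u v = fourierCoeff (fun t => ∑ j, v j t * star (u j t)) 0 := by
    rw [← inner_shift_eq_fourierCoeff, shift_zero]
  rw [h0]
  refine ae_eq_const_of_fourierCoeff_eq_zero (integrable_rowInner u v) fun n hn => ?_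
  rw [← inner_shift_eq_fourierCoeff]
  rcases lt_or_gt_of_ne hn with h | h
  · rw [inner_shift_left, ← inner_conj_symm]
    obtain ⟨m, hm⟩ : ∃ m : ℕ, -n = m + 1 := ⟨(-n - 1).toNat, by omega⟩
    rw [hm, inner_shift_eq_zero_of_mem_wandering hinv hv.1 hu, map_zero]
  · obtain ⟨m, hm⟩ : ∃ m : ℕ, n = m + 1 := ⟨(n - 1).toNat, by omega⟩
    rw [hm, inner_shift_eq_zero_of_mem_wandering hinv hu.1 hv]

theorem ae_mul_conjTranspose_eq_one {k m : ℕ} {P : Submodule ℂ (Row k)}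
    (hinv : ∀ f ∈ P, shift 1 f ∈ P) {b : Fin m → Row k} (hb : Orthonormal ℂ b)
    (hW : ∀ i, b i ∈ wandering P) :
    ∀ᵐ t ∂μc, (Matrix.of fun i j => b i j t) * (Matrix.of fun i j => b i j t)ᴴ = 1 := by
  have h : ∀ᵐ t ∂μc, ∀ i i', ∑ j, b i j t * star (b i' j t) = inner ℂ (b i') (b i) :=
    ae_all_iff.2 fun i => ae_all_iff.2 fun i' => ae_inner_eq_of_mem_wandering hinv (hW i') (hW i)
  filter_upwards [h] with t ht
  ext i i'
  rw [Matrix.mul_apply]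
  simp only [Matrix.of_apply, Matrix.conjTranspose_apply]
  rw [ht, orthonormal_iff_ite.1 hb, Matrix.one_apply]
  simp only [eq_comm]

theorem le_of_orthonormal_mem_wandering {k m : ℕ} {P : Submodule ℂ (Row k)}
    (hinv : ∀ f ∈ P, shift 1 f ∈ P) {b : Fin m → Row k} (hb : Orthonormal ℂ b)
    (hW : ∀ i, b i ∈ wandering P) : m ≤ k := by
  obtain ⟨t, ht⟩ := (ae_mul_conjTranspose_eq_one hinv hb hW).exists
  have h := Matrix.rank_mul_le_left (Matrix.of fun i j => b i j t)
    (Matrix.of fun i j => b i j t)ᴴ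
  rw [ht, Matrix.rank_one, Fintype.card_fin] at h
  exact h.trans (Matrix.rank_le_width _)

theorem rank_wandering_le {k : ℕ} {P : Submodule ℂ (Row k)} (hinv : ∀ f ∈ P, shift 1 f ∈ P) :
    Module.rank ℂ (wandering P) ≤ k := by
  refine rank_le fun s hs => ?_
  let b := stdOrthonormalBasis ℂ (Submodule.span ℂ (s : Set (wandering P)))
  have hcard : Module.finrank ℂ (Submodule.span ℂ (s : Set (wandering P))) = s.card :=
    finrank_span_finset_eq_card hs
  rw [← hcard]
  refine le_of_orthonormal_mem_wandering hinv
    (b := fun i => ((b i : wandering P) : Row k)) ?_ (fun i => (b i : wandering P).2)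
  exact (b.orthonormal.comp_linearIsometry (Submodule.subtypeₗᵢ _)).comp_linearIsometry
    (Submodule.subtypeₗᵢ _)

theorem norm_le_one_of_mul_conjTranspose_eq_one {m k : ℕ} {A : Matrix (Fin m) (Fin k) ℂ}
    (hA : A * Aᴴ = 1) (i : Fin m) (j : Fin k) : ‖A i j‖ ≤ 1 := by
  have h : ∑ j, A i j * star (A i j) = 1 := by
    have := congrFun (congrFun hA i) i
    simpa [Matrix.mul_apply] using this
  have h2 : ∑ j, ‖A i j‖ ^ 2 = 1 := by
    have h3 : ((∑ j, ‖A i j‖ ^ 2 : ℝ) : ℂ) = 1 := by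
      rw [← h, Complex.ofReal_sum]
      refine Finset.sum_congr rfl fun j _ => ?_
      rw [← starRingEnd_apply, Complex.mul_conj']
      push_cast; rfl
    exact_mod_cast h3
  have h4 : ‖A i j‖ ^ 2 ≤ 1 := h2 ▸
    Finset.single_le_sum (f := fun j => ‖A i j‖ ^ 2) (fun _ _ => sq_nonneg _) (Finset.mem_univ j)
  nlinarith [norm_nonneg (A i j)]

/-- The Beurling-Lax theorem for the subspaces of row vectors which are invariant under
multiplication by `z`. -/
theorem exists_isCoInner_of_shift_invariant {k : ℕ} {P : Submodule ℂ (Row k)}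
    (hP : IsClosed (P : Set (Row k))) (hH : P ≤ hardyRow k)
    (hinv : ∀ f ∈ P, shift 1 f ∈ P) (hne : P ≠ ⊥) :
    ∃ l : ℕ, 1 ≤ l ∧ l ≤ k ∧ ∃ J : MatL ∞ l k, IsCoInner J ∧
      P = (hardyRow l).map (rowMul J).toLinearMap := by
  have : FiniteDimensional ℂ (wandering P) :=
    Module.rank_lt_aleph0_iff.1
      ((rank_wandering_le hinv).trans_lt Cardinal.natCast_lt_aleph0)
  set l := Module.finrank ℂ (wandering P) with hl
  let b := stdOrthonormalBasis ℂ (wandering P)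
  let w : Fin l → Row k := fun i => (b i : Row k)
  have hw : Orthonormal ℂ w := b.orthonormal.comp_linearIsometry (Submodule.subtypeₗᵢ _)
  have hwW : ∀ i, w i ∈ wandering P := fun i => (b i).2
  have hae := ae_mul_conjTranspose_eq_one hinv hw hwW
  have hbd : ∀ i j, MemLp (w i j) ∞ μc := fun i j => by
    refine memLp_top_of_bound (Lp.aestronglyMeasurable _) 1 ?_
    filter_upwards [hae] with t ht
    exact norm_le_one_of_mul_conjTranspose_eq_one ht i j
  let J : MatL ∞ l k := Matrix.of fun i j => (hbd i j).toLp (w i j)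
  have hJw : ∀ i j, J i j =ᵐ[μc] w i j := fun i j => (hbd i j).coeFn_toLp
  have hJ : IsCoInner J := by
    refine ⟨fun i j n hn => ?_, ?_⟩
    · rw [fourierCoeff_congr_ae (hJw i j), ← coeff_apply]
      exact mem_hardyRow.1 (hH (hwW i).1) j n hn
    · filter_upwards [hae, ae_all_iff.2 fun i => ae_all_iff.2 fun j => hJw i j] with t h1 h2
      have : pointValue J t = Matrix.of fun i j => w i j t := by
        ext i j; exact h2 i j
      rw [this, h1]
  have hmono : ∀ (i : Fin l) (n : ℤ), rowMul J (monoRow i n) = shift n (w i) := by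
    intro i n
    ext1 j
    rw [rowMul_apply, Finset.sum_eq_single i]
    · rw [monoRow, PiLp.single_eq_same, shift_apply]
      apply Lp.ext
      filter_upwards [coeFn_mulL (J i j) (fourierLp 2 n), hJw i j, coeFn_zmul n (w i j),
        coeFn_fourierLp (T := 2 * Real.pi) 2 n] with t h1 h2 h3 h4
      rw [h1, h2, h3, h4, mul_comm]
    · intro s _ hs
      rw [monoRow, PiLp.single_eq_of_ne 2 hs, map_zero]
    · simp
  have hle : (hardyRow l).map (rowMul J).toLinearMap ≤ P := by
    rw [Submodule.map_le_iff_le_comap]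
    refine hardyRow_le_of_monoRow_mem (hP.preimage (rowMul J).continuous) fun i n => ?_
    rw [Submodule.mem_comap]
    change rowMul J (monoRow i n) ∈ P
    rw [hmono]
    exact shift_nat_mem hinv (hwW i).1 n
  have hclosed : IsClosed ((hardyRow l).map (rowMul J).toLinearMap : Set (Row k)) :=
    (rowMulIsometry J hJ.2).isometry.isClosedEmbedding.isClosedMap _ (isClosed_hardyRow l)
  have hPeq : P = (hardyRow l).map (rowMul J).toLinearMap := by
    refine le_antisymm (fun f hf => ?_) hle
    have : CompleteSpace ((hardyRow l).map (rowMul J).toLinearMap) := hclosed.completeSpace_coe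
    obtain ⟨p, hp, q, hq, hpq⟩ :=
      ((hardyRow l).map (rowMul J).toLinearMap).exists_add_mem_mem_orthogonal f
    have hqP : q ∈ P := by
      have : q = f - p := by rw [hpq, add_sub_cancel_left]
      rw [this]
      exact P.sub_mem hf (hle hp)
    have hq0 : q = 0 := by
      refine eq_zero_of_orthogonal_wandering hP hH hqP (fun n v hv => ?_) hinv
      have hsum : v = ∑ i, b.repr ⟨v, hv⟩ i • w i := by
        have := congrArg (Subtype.val) (b.sum_repr ⟨v, hv⟩)
        simpa using this.symm
      rw [hsum, map_sum, sum_inner]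
      refine Finset.sum_eq_zero fun i _ => ?_
      rw [map_smul, inner_smul_left, ← hmono]
      have hmem : rowMul J (monoRow i n) ∈ (hardyRow l).map (rowMul J).toLinearMap :=
        Submodule.mem_map_of_mem (monoRow_mem_hardyRow i (Int.natCast_nonneg n))
      rw [Submodule.inner_right_of_mem_orthogonal hmem hq, mul_zero]
    rw [hpq, hq0, add_zero]
    exact hp
  refine ⟨l, ?_, ?_, J, hJ, hPeq⟩
  · rw [Nat.one_le_iff_ne_zero]
    intro h0
    have hWbot : wandering P = ⊥ := Submodule.finrank_eq_zero.1 h0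
    refine hne ((Submodule.eq_bot_iff _).2 fun f hf => ?_)
    refine eq_zero_of_orthogonal_wandering hP hH hf (fun n v hv => ?_) hinv
    rw [hWbot, Submodule.mem_bot] at hv
    rw [hv, map_zero, inner_zero_left]
  · exact le_of_orthonormal_mem_wandering hinv hw hwW

theorem injective_rowMul {l k : ℕ} {J : MatL ∞ l k} (hJ : IsCoInner J) :
    Function.Injective (rowMul J) :=
  (rowMulIsometry J hJ.2).injective

theorem isClosed_map_rowMul {l k : ℕ} {J : MatL ∞ l k} (hJ : IsCoInner J)
    {P : Submodule ℂ (Row l)} (hP : IsClosed (P : Set (Row l))) :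
    IsClosed (P.map (rowMul J).toLinearMap : Set (Row k)) :=
  (rowMulIsometry J hJ.2).isometry.isClosedEmbedding.isClosedMap _ hP

/-- The smallest closed subspace containing `N` and `z N`. -/
def shiftHull {k : ℕ} (N : Submodule ℂ (Row k)) : Submodule ℂ (Row k) :=
  (N ⊔ shiftImage N).topologicalClosure

theorem le_shiftHull {k : ℕ} (N : Submodule ℂ (Row k)) : N ≤ shiftHull N :=
  le_sup_left.trans (Submodule.le_topologicalClosure _)

theorem shiftHull_le {k : ℕ} {N Q : Submodule ℂ (Row k)} (hQ : IsClosed (Q : Set (Row k)))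
    (h0 : N ≤ Q) (h1 : ∀ f ∈ N, shift 1 f ∈ Q) : shiftHull N ≤ Q := by
  refine Submodule.topologicalClosure_minimal _ (sup_le h0 fun f hf => ?_) hQ
  have := h1 _ (mem_shiftImage.1 hf)
  rwa [shift_shift_neg] at this

theorem shift_mem_of_mem_shiftHull {k : ℕ} {N Q : Submodule ℂ (Row k)}
    (hQ : IsClosed (Q : Set (Row k))) (n : ℤ) (h0 : ∀ f ∈ N, shift n f ∈ Q)
    (h1 : ∀ f ∈ N, shift (n + 1) f ∈ Q) {f : Row k} (hf : f ∈ shiftHull N) : shift n f ∈ Q := by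
  have hle : shiftHull N ≤ shiftComap n Q := by
    refine shiftHull_le (isClosed_shiftComap n hQ) (fun f hf => ?_) (fun f hf => ?_)
    · exact mem_shiftComap.2 (h0 f hf)
    · rw [mem_shiftComap, shift_shift]
      exact h1 f hf
  exact mem_shiftComap.1 (hle hf)

/-- The coefficients of index `0` and `1` of a row vector. -/
def lowCoeff (l : ℕ) : Row l →ₗ[ℂ] EuclideanSpace ℂ (Fin l ⊕ Fin l) :=
  (WithLp.linearEquiv 2 ℂ (Fin l ⊕ Fin l → ℂ)).symm.toLinearMap ∘ₗ
    LinearMap.pi (Sum.elim (fun j => (rowCoeff j 0).toLinearMap)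
      (fun j => (rowCoeff j 1).toLinearMap))

theorem lowCoeff_inl {l : ℕ} (g : Row l) (j : Fin l) :
    lowCoeff l g (Sum.inl j) = rowCoeff j 0 g := rfl

theorem lowCoeff_inr {l : ℕ} (g : Row l) (j : Fin l) :
    lowCoeff l g (Sum.inr j) = rowCoeff j 1 g := rfl

/-- The coefficients of index `0` of a row vector. -/
def constCoeff (l : ℕ) : Row l →L[ℂ] (Fin l → ℂ) := ContinuousLinearMap.pi fun j => rowCoeff j 0

theorem constCoeff_apply {l : ℕ} (g : Row l) (j : Fin l) : constCoeff l g j = rowCoeff j 0 g := rfl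

/-- The first half of a vector. -/
def firstHalf (l : ℕ) : EuclideanSpace ℂ (Fin l ⊕ Fin l) →ₗ[ℂ] (Fin l → ℂ) :=
  LinearMap.funLeft ℂ ℂ Sum.inl ∘ₗ
    (WithLp.linearEquiv 2 ℂ (Fin l ⊕ Fin l → ℂ)).toLinearMap

theorem exists_shift_two_of_lowCoeff_eq_zero {l : ℕ} {g : Row l} (hg : g ∈ hardyRow l)
    (h : lowCoeff l g = 0) : shift (-2) g ∈ hardyRow l := by
  rw [mem_hardyRow] at hg ⊢
  intro j n hn
  rw [rowCoeff_shift]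
  rcases lt_or_ge (n + 2) 0 with h0 | h0
  · exact hg j _ (by omega)
  · obtain h1 | h1 : n - -2 = 0 ∨ n - -2 = 1 := by omega
    · rw [h1, ← lowCoeff_inl, h]; rfl
    · rw [h1, ← lowCoeff_inr, h]; rfl

/-- Every finite-dimensional subspace of `ℂ^{2l}` is the row space of a matrix `[α β]` with
orthonormal rows. -/
theorem exists_mem_gBar_of_subspace {l : ℕ} (S : Submodule ℂ (EuclideanSpace ℂ (Fin l ⊕ Fin l))) :
    ∃ α β : Matrix (Fin (Module.finrank ℂ S)) (Fin l) ℂ, (α, β) ∈ GBar (Module.finrank ℂ S) l ∧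
      ∀ v : EuclideanSpace ℂ (Fin l ⊕ Fin l), v ∈ S ↔
        ∃ u : Fin (Module.finrank ℂ S) → ℂ,
          (fun j => v (Sum.inl j)) = u ᵥ* α ∧ (fun j => v (Sum.inr j)) = u ᵥ* β := by
  let b := stdOrthonormalBasis ℂ S
  refine ⟨Matrix.of fun i j => (b i : EuclideanSpace ℂ (Fin l ⊕ Fin l)) (Sum.inl j),
    Matrix.of fun i j => (b i : EuclideanSpace ℂ (Fin l ⊕ Fin l)) (Sum.inr j), ?_, fun v => ?_⟩
  · change _ + _ = _
    ext i i'
    have h := orthonormal_iff_ite.1 b.orthonormal i' i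
    rw [Submodule.coe_inner, PiLp.inner_apply, Fintype.sum_sum_type] at h
    rw [Matrix.add_apply, Matrix.mul_apply, Matrix.mul_apply, Matrix.one_apply]
    simp only [Matrix.of_apply, Matrix.conjTranspose_apply]
    simp only [RCLike.inner_apply, starRingEnd_apply] at h
    rw [h]
    simp only [eq_comm]
  · have key : ∀ u : Fin (Module.finrank ℂ S) → ℂ,
        ((fun j => v (Sum.inl j)) = u ᵥ* (Matrix.of fun i j =>
            (b i : EuclideanSpace ℂ (Fin l ⊕ Fin l)) (Sum.inl j)) ∧
          (fun j => v (Sum.inr j)) = u ᵥ* (Matrix.of fun i j =>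
            (b i : EuclideanSpace ℂ (Fin l ⊕ Fin l)) (Sum.inr j))) ↔
        v = ∑ i, u i • (b i : EuclideanSpace ℂ (Fin l ⊕ Fin l)) := by
      intro u
      constructor
      · rintro ⟨h1, h2⟩
        ext (j | j)
        · have := congrFun h1 j
          simpa [Matrix.vecMul, dotProduct] using this
        · have := congrFun h2 j
          simpa [Matrix.vecMul, dotProduct] using this
      · rintro rfl
        constructor <;> funext j <;> simp [Matrix.vecMul, dotProduct]
    simp only [key]
    constructor
    · intro hv
      refine ⟨fun i => b.repr ⟨v, hv⟩ i, ?_⟩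
      have := congrArg Subtype.val (b.sum_repr ⟨v, hv⟩)
      simpa using this.symm
    · rintro ⟨u, rfl⟩
      exact S.sum_mem fun i _ => S.smul_mem _ (b i).2

/-- The representation of the closed subspaces of row vectors in `H²` which are invariant under
multiplication by `z ^ 2` and `z ^ 3`. -/
theorem exists_representation_of_shift_two_three_invariant {k : ℕ} {N : Submodule ℂ (Row k)}
    (hN : IsClosed (N : Set (Row k))) (hH : N ≤ hardyRow k) (h2 : ∀ f ∈ N, shift 2 f ∈ N)
    (h3 : ∀ f ∈ N, shift 3 f ∈ N) (hne : N ≠ ⊥) :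
    ∃ l l' : ℕ, 1 ≤ l ∧ l ≤ k ∧ l ≤ l' ∧ l' ≤ 2 * l ∧ ∃ J : MatL ∞ l k, IsCoInner J ∧
      ∃ α β : Matrix (Fin l') (Fin l) ℂ, (α, β) ∈ GBar l' l ∧
        ∀ f, f ∈ N ↔ ∃ g ∈ hardyRow l, (∃ u : Fin l' → ℂ,
          (fun j => rowCoeff j 0 g) = u ᵥ* α ∧ (fun j => rowCoeff j 1 g) = u ᵥ* β) ∧
          rowMul J g = f := by
  have hPc : IsClosed (shiftHull N : Set (Row k)) := Submodule.isClosed_topologicalClosure _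
  have hNP := le_shiftHull N
  have hPH : shiftHull N ≤ hardyRow k :=
    shiftHull_le (isClosed_hardyRow k) hH fun f hf => shift_mem_hardyRow zero_le_one (hH hf)
  have hP1 : ∀ f ∈ shiftHull N, shift 1 f ∈ shiftHull N := fun f hf =>
    shift_mem_of_mem_shiftHull hPc 1
      (fun f hf => Submodule.le_topologicalClosure _ (Submodule.mem_sup_right (by
        rw [mem_shiftImage, shift_neg_shift]; exact hf)))
      (fun f hf => hNP (h2 f hf)) hf
  have hP2 : ∀ f ∈ shiftHull N, shift 2 f ∈ N := fun f hf =>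
    shift_mem_of_mem_shiftHull hN 2 h2 h3 hf
  have hPne : shiftHull N ≠ ⊥ := fun h => hne (le_bot_iff.1 (h ▸ hNP))
  obtain ⟨l, hl1, hlk, J, hJ, hPJ⟩ := exists_isCoInner_of_shift_invariant hPc hPH hP1 hPne
  let S : Submodule ℂ (EuclideanSpace ℂ (Fin l ⊕ Fin l)) :=
    (hardyRow l ⊓ N.comap (rowMul J).toLinearMap).map (lowCoeff l)
  have hmem : ∀ g ∈ hardyRow l, (lowCoeff l g ∈ S ↔ rowMul J g ∈ N) := by
    intro g hg
    constructor
    · rintro ⟨g', ⟨hg', hgN⟩, hgg'⟩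
      have hd : shift (-2) (g - g') ∈ hardyRow l :=
        exists_shift_two_of_lowCoeff_eq_zero ((hardyRow l).sub_mem hg hg')
          (by rw [map_sub, hgg', sub_self])
      have hd2 : rowMul J (shift (-2) (g - g')) ∈ shiftHull N := by
        rw [hPJ]; exact Submodule.mem_map_of_mem hd
      have hd3 := hP2 _ hd2
      rw [← rowMul_shift, shift_shift_neg] at hd3
      have := N.add_mem hd3 hgN
      change rowMul J (g - g') + rowMul J g' ∈ N at this
      rwa [← map_add, sub_add_cancel] at this
    · intro h
      exact Submodule.mem_map_of_mem ⟨hg, h⟩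
  have hfirst : S.map (firstHalf l) = ⊤ := by
    let Q : Submodule ℂ (Row l) :=
      hardyRow l ⊓ (S.map (firstHalf l)).comap (constCoeff l).toLinearMap
    have hQ : IsClosed (Q : Set (Row l)) :=
      (isClosed_hardyRow l).inter
        ((S.map (firstHalf l)).closed_of_finiteDimensional.preimage (constCoeff l).continuous)
    have hPQ : shiftHull N ≤ Q.map (rowMul J).toLinearMap := by
      have hlift : ∀ f ∈ N, ∃ g ∈ hardyRow l, rowMul J g = f := fun f hf => by
        have := hNP hf
        rw [hPJ] at this
        exact this
      refine shiftHull_le (isClosed_map_rowMul hJ hQ) (fun f hf => ?_) (fun f hf => ?_)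
      · obtain ⟨g, hg, rfl⟩ := hlift f hf
        exact Submodule.mem_map_of_mem
          ⟨hg, Submodule.mem_map_of_mem (f := firstHalf l) ((hmem g hg).2 hf)⟩
      · obtain ⟨g, hg, rfl⟩ := hlift f hf
        rw [← rowMul_shift]
        refine Submodule.mem_map_of_mem (f := (rowMul J).toLinearMap)
          ⟨shift_mem_hardyRow zero_le_one hg, ?_⟩
        have : constCoeff l (shift 1 g) = 0 := by
          funext j
          rw [constCoeff_apply, rowCoeff_shift]
          exact mem_hardyRow.1 hg j _ (by norm_num)
        change constCoeff l (shift 1 g) ∈ S.map (firstHalf l)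
        rw [this]
        exact Submodule.zero_mem _
    refine (Submodule.eq_top_iff').2 fun v => ?_
    rw [pi_eq_sum_univ' v]
    refine Submodule.sum_mem _ fun s _ => Submodule.smul_mem _ _ ?_
    have hs : rowMul J (monoRow s 0) ∈ shiftHull N := by
      rw [hPJ]
      exact Submodule.mem_map_of_mem (f := (rowMul J).toLinearMap) (monoRow_mem_hardyRow s le_rfl)
    obtain ⟨g, hg, hgs⟩ := hPQ hs
    have hgs' : g = monoRow s 0 := injective_rowMul hJ hgs
    have hg2 : constCoeff l g ∈ S.map (firstHalf l) := hg.2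
    convert hg2 using 1
    funext j
    rw [hgs', constCoeff_apply, rowCoeff_apply, monoRow]
    rcases eq_or_ne s j with rfl | hsj
    · rw [PiLp.single_eq_same, coeff_fourierLp]; simp
    · rw [PiLp.single_eq_of_ne 2 hsj.symm, map_zero, Pi.single_eq_of_ne hsj.symm]
  obtain ⟨α, β, hαβ, hS⟩ := exists_mem_gBar_of_subspace S
  refine ⟨l, Module.finrank ℂ S, hl1, hlk, ?_, ?_, J, hJ, α, β, hαβ, fun f => ?_⟩
  · have := Submodule.finrank_map_le (firstHalf l) S
    rwa [hfirst, finrank_top, Module.finrank_fin_fun] at this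
  · have := Submodule.finrank_le S
    rwa [finrank_euclideanSpace, Fintype.card_sum, Fintype.card_fin, ← two_mul] at this
  · constructor
    · intro hf
      have hfP := hNP hf
      rw [hPJ] at hfP
      obtain ⟨g, hg, hgf⟩ := hfP
      change rowMul J g = f at hgf
      exact ⟨g, hg, (hS (lowCoeff l g)).1 ((hmem g hg).2 (hgf ▸ hf)), hgf⟩
    · rintro ⟨g, hg, hu, rfl⟩
      exact (hmem g hg).1 ((hS (lowCoeff l g)).2 hu)

/-- The `i`-th row of a matrix of `L²` functions. -/
def rowOf {k l : ℕ} (F : MatL 2 k l) (i : Fin k) : Row l := WithLp.toLp 2 (F i)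

theorem rowOf_apply {k l : ℕ} (F : MatL 2 k l) (i : Fin k) (j : Fin l) :
    rowOf F i j = F i j := rfl

theorem rowOf_mulRight {k l m : ℕ} (G : MatL 2 k l) (J : MatL ∞ l m) (i : Fin k) :
    rowOf (mulRight G J) i = rowMul J (rowOf G i) := by
  ext1 j
  rw [rowMul_apply, rowOf_apply]
  rfl

theorem rowOf_injective {k l : ℕ} {F G : MatL 2 k l} (h : ∀ i, rowOf F i = rowOf G i) : F = G := by
  ext1 i j
  rw [← rowOf_apply F, h i, rowOf_apply]

/-- The matrix with `i`-th row `f` and all other rows zero. -/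
def rowEmb {k : ℕ} (i : Fin k) : Row k →ₗ[ℂ] MatL 2 k k where
  toFun f := Matrix.of fun r j => if r = i then f j else 0
  map_add' f g := by
    ext1 r j
    by_cases h : r = i <;> simp [h]
  map_smul' c f := by
    ext1 r j
    by_cases h : r = i <;> simp [h]

theorem rowEmb_apply {k : ℕ} (i : Fin k) (f : Row k) (r j : Fin k) :
    rowEmb i f r j = if r = i then f j else 0 := rfl

theorem continuous_rowEmb {k : ℕ} (i : Fin k) : Continuous (rowEmb i) := by
  refine continuous_pi fun r => continuous_pi fun j => ?_
  change Continuous fun f : Row k => if r = i then f j else 0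
  by_cases h : r = i
  · simp only [h, if_true]
    exact PiLp.continuous_apply 2 _ j
  · simp only [h, if_false]
    exact continuous_const

theorem sum_rowEmb_rowOf {k : ℕ} (F : MatL 2 k k) : ∑ i, rowEmb i (rowOf F i) = F := by
  ext1 r j
  rw [Matrix.sum_apply]
  simp [rowEmb_apply, rowOf_apply]

/-- The matrix with entry `z ^ n` at `(a, b)` and zero elsewhere. -/
def monoUnit {k : ℕ} (a b : Fin k) (n : ℤ) : MatL ∞ k k :=
  Matrix.of fun r c => if r = a ∧ c = b then fourierLp ∞ n else 0

theorem fourierCoeff_fourierLp_top (n m : ℤ) :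
    fourierCoeff (fourierLp (T := 2 * Real.pi) ∞ n) m = if m = n then 1 else 0 := by
  rw [fourierCoeff_congr_ae (coeFn_fourierLp ∞ n), fourierCoeff_fourier, Pi.single_apply]

theorem fourierCoeff_coe_zero (m : ℤ) : fourierCoeff ((0 : LCirc ∞) : UCircle → ℂ) m = 0 := by
  rw [fourierCoeff_congr_ae (Lp.coeFn_zero ℂ ∞ μc)]
  simp [fourierCoeff]

theorem monoUnit_mem_hardyInftyOne {k : ℕ} (a b : Fin k) {n : ℤ} (hn : 0 ≤ n) (hn1 : n ≠ 1) :
    monoUnit a b n ∈ HardyInftyOne k := by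
  refine ⟨fun r c m hm => ?_, ?_⟩
  · rw [monoUnit, Matrix.of_apply]
    split_ifs
    · rw [fourierCoeff_fourierLp_top, if_neg (by omega)]
    · exact fourierCoeff_coe_zero m
  · ext r c
    rw [derivZero, Matrix.of_apply, deriv_diskExt_zero, monoUnit, Matrix.of_apply]
    split_ifs
    · rw [fourierCoeff_fourierLp_top, if_neg hn1.symm, Matrix.zero_apply]
    · exact fourierCoeff_coe_zero 1

theorem mulLeft_monoUnit {k : ℕ} (a b : Fin k) (n : ℤ) (F : MatL 2 k k) :
    mulLeft (monoUnit a b n) F = rowEmb a (shift n (rowOf F b)) := by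
  ext1 r j
  change ∑ s, mulL (monoUnit a b n r s) (F s j) = if r = a then zmul n (F b j) else 0
  have h0 : ∀ f : LCirc 2, mulL 0 f = 0 := fun f => Lp.zero_smul ℂ ∞ f
  have hs : ∀ s, mulL (monoUnit a b n r s) (F s j) =
      if s = b then (if r = a then zmul n (F b j) else 0) else 0 := by
    intro s
    rw [monoUnit, Matrix.of_apply]
    by_cases hr : r = a <;> by_cases hs : s = b
    · rw [if_pos ⟨hr, hs⟩, if_pos hs, if_pos hr, hs, zmul_apply]
    · rw [if_neg (fun h => hs h.2), if_neg hs, h0]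
    · rw [if_neg (fun h => hr h.1), if_pos hs, if_neg hr, h0]
    · rw [if_neg (fun h => hs h.2), if_neg hs, h0]
  simp only [hs, Finset.sum_ite_eq', Finset.mem_univ, if_true]

/-- The space of the row vectors all of whose embeddings as a single row lie in `M`. -/
def rowSpace {k : ℕ} (M : Submodule ℂ (MatL 2 k k)) : Submodule ℂ (Row k) :=
  ⨅ i, M.comap (rowEmb i)

theorem mem_rowSpace {k : ℕ} {M : Submodule ℂ (MatL 2 k k)} {f : Row k} :
    f ∈ rowSpace M ↔ ∀ i, rowEmb i f ∈ M := by
  simp [rowSpace, Submodule.mem_iInf]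

theorem isClosed_rowSpace {k : ℕ} {M : Submodule ℂ (MatL 2 k k)}
    (hM : IsClosed (M : Set (MatL 2 k k))) : IsClosed (rowSpace M : Set (Row k)) := by
  simp only [rowSpace, Submodule.coe_iInf]
  exact isClosed_iInter fun i => hM.preimage (continuous_rowEmb i)

theorem mem_iff_forall_rowOf_mem_rowSpace {k : ℕ} {M : Submodule ℂ (MatL 2 k k)}
    (hinv : ∀ F ∈ HardyInftyOne k, ∀ h ∈ M, mulLeft F h ∈ M) {F : MatL 2 k k} :
    F ∈ M ↔ ∀ i, rowOf F i ∈ rowSpace M := by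
  constructor
  · intro hF i
    rw [mem_rowSpace]
    intro a
    have := hinv _ (monoUnit_mem_hardyInftyOne a i le_rfl (by norm_num)) F hF
    rwa [mulLeft_monoUnit, shift_zero] at this
  · intro h
    rw [← sum_rowEmb_rowOf F]
    exact M.sum_mem fun i _ => mem_rowSpace.1 (h i) i

theorem shift_mem_rowSpace {k : ℕ} {M : Submodule ℂ (MatL 2 k k)}
    (hinv : ∀ F ∈ HardyInftyOne k, ∀ h ∈ M, mulLeft F h ∈ M) {n : ℤ} (hn : 0 ≤ n) (hn1 : n ≠ 1)
    {f : Row k} (hf : f ∈ rowSpace M) : shift n f ∈ rowSpace M := by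
  rw [mem_rowSpace] at hf ⊢
  intro i
  have := hinv _ (monoUnit_mem_hardyInftyOne i i hn hn1) _ (hf i)
  rw [mulLeft_monoUnit] at this
  convert this using 3
  ext1 j
  rw [rowOf_apply, rowEmb_apply, if_pos rfl]

theorem rowSpace_le_hardyRow {k : ℕ} {M : Submodule ℂ (MatL 2 k k)}
    (hM : (M : Set (MatL 2 k k)) ⊆ Hardy 2 k k) : rowSpace M ≤ hardyRow k := by
  intro f hf
  rw [mem_hardyRow]
  intro j n hn
  have := hM (mem_rowSpace.1 hf j) j j n hn
  rwa [rowEmb_apply, if_pos rfl, ← coeff_apply] at this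

theorem rowSpace_ne_bot {k : ℕ} {M : Submodule ℂ (MatL 2 k k)}
    (hinv : ∀ F ∈ HardyInftyOne k, ∀ h ∈ M, mulLeft F h ∈ M) (hne : M ≠ ⊥) :
    rowSpace M ≠ ⊥ := by
  intro h
  refine hne ((Submodule.eq_bot_iff _).2 fun F hF => rowOf_injective fun i => ?_)
  have := (mem_iff_forall_rowOf_mem_rowSpace hinv).1 hF i
  rw [h, Submodule.mem_bot] at this
  rw [this]
  rfl

theorem mem_hardy_iff_rowOf {k l : ℕ} {G : MatL 2 k l} :
    G ∈ Hardy 2 k l ↔ ∀ i, rowOf G i ∈ hardyRow l := by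
  simp only [mem_hardyRow, rowCoeff_apply, coeff_apply, rowOf_apply]
  rfl

theorem valueZero_apply {k l : ℕ} (G : MatL 2 k l) (i : Fin k) (j : Fin l) :
    valueZero G i j = rowCoeff j 0 (rowOf G i) := by
  rw [valueZero, Matrix.of_apply, diskExt_zero, rowCoeff_apply, coeff_apply, rowOf_apply]

theorem derivZero_apply {k l : ℕ} (G : MatL 2 k l) (i : Fin k) (j : Fin l) :
    derivZero G i j = rowCoeff j 1 (rowOf G i) := by
  rw [derivZero, Matrix.of_apply, deriv_diskExt_zero, rowCoeff_apply, coeff_apply, rowOf_apply]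

theorem mem_hardyAB_iff_rowOf {k l l' : ℕ} {α β : Matrix (Fin l') (Fin l) ℂ} {G : MatL 2 k l} :
    G ∈ HardyAB k α β ↔ ∀ i, rowOf G i ∈ hardyRow l ∧ ∃ u : Fin l' → ℂ,
      (fun j => rowCoeff j 0 (rowOf G i)) = u ᵥ* α ∧
        (fun j => rowCoeff j 1 (rowOf G i)) = u ᵥ* β := by
  constructor
  · rintro ⟨hG, U, h0, h1⟩ i
    refine ⟨mem_hardy_iff_rowOf.1 hG i, U i, ?_, ?_⟩
    · funext j
      rw [← valueZero_apply, h0]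
      rfl
    · funext j
      rw [← derivZero_apply, h1]
      rfl
  · intro h
    choose hG u h0 h1 using h
    refine ⟨mem_hardy_iff_rowOf.2 hG, Matrix.of u, ?_, ?_⟩
    · ext i j
      rw [valueZero_apply]
      exact congrFun (h0 i) j
    · ext i j
      rw [derivZero_apply]
      exact congrFun (h1 i) j

end ConstrainedHardy

end

theorem theorem2p8 (k : ℕ)
    (M : Submodule ℂ (ConstrainedHardy.MatL 2 k k))
    (hM_closed : IsClosed (M : Set (ConstrainedHardy.MatL 2 k k)))
    (hM_hardy : (M : Set (ConstrainedHardy.MatL 2 k k)) ⊆ ConstrainedHardy.Hardy 2 k k)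
    (hM_ne : M ≠ ⊥)
    (hM_inv : ∀ F ∈ ConstrainedHardy.HardyInftyOne k, ∀ h ∈ M,
      ConstrainedHardy.mulLeft F h ∈ M) :
    ∃ l l' : ℕ, 1 ≤ l ∧ l ≤ k ∧ l ≤ l' ∧ l' ≤ 2 * l ∧
      ∃ J : ConstrainedHardy.MatL ∞ l k, ConstrainedHardy.IsCoInner J ∧
        ∃ α β : Matrix (Fin l') (Fin l) ℂ, (α, β) ∈ ConstrainedHardy.GBar l' l ∧
          (M : Set (ConstrainedHardy.MatL 2 k k)) =
            (fun F : ConstrainedHardy.MatL 2 k l => ConstrainedHardy.mulRight F J) ''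
              ConstrainedHardy.HardyAB k α β := by
  open ConstrainedHardy in
  obtain ⟨l, l', h1, h2, h3, h4, J, hJ, α, β, hαβ, hN⟩ :=
    exists_representation_of_shift_two_three_invariant (isClosed_rowSpace hM_closed)
      (rowSpace_le_hardyRow hM_hardy)
      (fun f hf => shift_mem_rowSpace hM_inv (by norm_num) (by norm_num) hf)
      (fun f hf => shift_mem_rowSpace hM_inv (by norm_num) (by norm_num) hf)
      (rowSpace_ne_bot hM_inv hM_ne)
  refine ⟨l, l', h1, h2, h3, h4, J, hJ, α, β, hαβ, Set.ext fun F => ?_⟩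
  rw [SetLike.mem_coe, ConstrainedHardy.mem_iff_forall_rowOf_mem_rowSpace hM_inv]
  simp only [hN]
  constructor
  · intro h
    choose g hg hu hgF using h
    refine ⟨Matrix.of fun i => (g i).ofLp,
      ConstrainedHardy.mem_hardyAB_iff_rowOf.2 fun i => ⟨hg i, hu i⟩,
      ConstrainedHardy.rowOf_injective fun i => ?_⟩
    rw [ConstrainedHardy.rowOf_mulRight]
    exact hgF i
  · rintro ⟨G, hG, rfl⟩ i
    obtain ⟨hg, hu⟩ := ConstrainedHardy.mem_hardyAB_iff_rowOf.1 hG i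
    exact ⟨ConstrainedHardy.rowOf G i, hg, hu, (ConstrainedHardy.rowOf_mulRight G J i).symm⟩
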